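/- Let $\ell \ge 2$, $\beta > 0$, and let $\mathcal H = (\mathbb C^2)^{\otimes \ell}$ be the space of a chain of $\ell$ sites, each site with basis $|0\rangle$ (empty), $|1\rangle$ (occupied). Let $a_j = Z^{\otimes (j-1)} \otimes |0\rangle\langle 1| \otimes 1^{\otimes(\ell-j)}$, with $Z = |0\rangle\langle 0| - |1\rangle\langle 1|$, be the Jordan–Wigner fermion annihilation operators, and put $$H = \sum_{j=1}^{\ell-1} \big(a_j^\dagger a_{j+1} + a_{j+1}^\dagger a_j\big), \qquad N = \sum_{j=1}^{\ell} a_j^\dagger a_j .$$ Let $A$ be the first site and $B$ the remaining $\ell-1$ sites, let $$\hat\rho_A = \frac{1}{1+e^{-\beta}}\big(e^{-\beta}|1\rangle\langle 1| + |0\rangle\langle 0|\big),$$ and for $\epsilon > 0$ let $\mathcal D_\epsilon \rho = \epsilon\,[\hat\rho_A \otimes \mathrm{Tr}_A \rho - \rho]$. A steady state for $\epsilon$ is a density matrix $\rho$ on $\mathcal H$ (positive semidefinite, trace one) with $-i[H,\rho] + \mathcal D_\epsilon\rho = 0$. Define $$\bar\rho = \Big(\frac{1}{1+e^{-\beta}}\big(e^{-\beta}|1\rangle\langle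 1| + |0\rangle\langle 0|\big)\Big)^{\otimes \ell}.$$ Then: 1. For every $\epsilon > 0$, $\bar\rho$ is a steady state, and it is the only one; in particular the steady state does not depend on $\epsilon$. 2. $\bar\rho = \big(\frac{1}{1+e^{-\beta}}\big)^{\ell} e^{-\beta N}$, and $\bar\rho = \hat\rho_A \otimes \rho_B$, where $\rho_B$ is the $(\ell-1)$-fold tensor power of the same one-site state. 3. As $\epsilon \to 0^+$, the steady states $\rho_\epsilon$ do not converge to a Gibbs state of $H$: for all real $\beta'$ and $\mu$, $\rho_\epsilon \not\to e^{-\beta'(H-\mu N)}/\mathrm{Tr}\, e^{-\beta'(H-\mu N)}$. In particular ($\mu = 0$, $\beta' = \beta$), they do not converge to $e^{-\beta H}/\mathrm{Tr}\, e^{-\beta H}$. -/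

import Mathlib

namespace SpinChain

open Matrix
open scoped ComplexOrder

/-- Operators on the Hilbert space `(ℂ²)^{⊗ n}` of `n` sites, as matrices in the occupation-number
basis: a basis vector is a configuration `s : Fin n → Fin 2`, where `s j = 0` means that site `j`
is empty and `s j = 1` that it is occupied. -/
abbrev Op (n : ℕ) : Type := Matrix (Fin n → Fin 2) (Fin n → Fin 2) ℂ

/-- Operators on a single site, in the basis `|0⟩, |1⟩`. -/
abbrev SiteOp : Type := Matrix (Fin 2) (Fin 2) ℂ

/-- The tensor product `M 0 ⊗ M 1 ⊗ ⋯ ⊗ M (n - 1)` of one-site operators. -/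
def siteTensor {n : ℕ} (M : Fin n → SiteOp) : Op n :=
  Matrix.of fun s t => ∏ k, M k (s k) (t k)

/-- The one-site lowering operator `|0⟩⟨1|`. -/
def lowering : SiteOp := !![0, 1; 0, 0]

/-- The one-site parity operator `(-1)^n = |0⟩⟨0| - |1⟩⟨1|`. -/
def parity : SiteOp := !![1, 0; 0, -1]

/-- The annihilation operator of the Jordan-Wigner fermion at site `j`: the lowering operator at
site `j`, parities at the sites before `j`, and the identity at the sites after `j`. -/
def annih {n : ℕ} (j : Fin n) : Op n :=
  siteTensor fun k => if k < j then parity else if k = j then lowering else 1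

/-- The XX Hamiltonian `∑_j (a_j† a_{j+1} + a_{j+1}† a_j)` on a chain of `m + 1` sites. -/
def hamiltonian (m : ℕ) : Op (m + 1) :=
  ∑ j : Fin m, ((annih j.castSucc)ᴴ * annih j.succ + (annih j.succ)ᴴ * annih j.castSucc)

/-- The particle number operator `N = ∑_j a_j† a_j`. -/
def number (n : ℕ) : Op n := ∑ j : Fin n, (annih j)ᴴ * annih j

/-- The tensor product `X ⊗ Y` of an operator on the first site (subsystem `A`) and an operator on
the remaining `m` sites (subsystem `B`). -/
def boundaryTensor {m : ℕ} (X : SiteOp) (Y : Op m) : Op (m + 1) :=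
  Matrix.of fun s t => X (s 0) (t 0) * Y (Fin.tail s) (Fin.tail t)

/-- The partial trace `Tr_A` over the first site. -/
def boundaryTrace {m : ℕ} (ρ : Op (m + 1)) : Op m :=
  Matrix.of fun s t => ∑ c : Fin 2, ρ (Fin.cons c s) (Fin.cons c t)

/-- The one-site state `(1 + e^{-β})⁻¹ (|0⟩⟨0| + e^{-β} |1⟩⟨1|)`. -/
noncomputable def siteState (β : ℝ) : SiteOp :=
  (1 + Real.exp (-β))⁻¹ • !![1, 0; 0, (Real.exp (-β) : ℂ)]

/-- The `n`-fold tensor power of the one-site state. -/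
noncomputable def productState (β : ℝ) (n : ℕ) : Op n := siteTensor fun _ => siteState β

/-- The reset dissipator `ρ ↦ ε [ρ̂_A ⊗ Tr_A ρ - ρ]` on the first site. -/
noncomputable def dissipator {m : ℕ} (β ε : ℝ) (ρ : Op (m + 1)) : Op (m + 1) :=
  ε • (boundaryTensor (siteState β) (boundaryTrace ρ) - ρ)

/-- The generator `ρ ↦ -i [H, ρ] + 𝒟 ρ` of the Lindblad equation. -/
noncomputable def lindbladian {m : ℕ} (β ε : ℝ) (ρ : Op (m + 1)) : Op (m + 1) :=
  -Complex.I • (hamiltonian m * ρ - ρ * hamiltonian m) + dissipator β ε ρ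

/-- Density matrices: positive semidefinite operators of trace one. -/
def IsDensityMatrix {n : ℕ} (ρ : Op n) : Prop := ρ.PosSemidef ∧ ρ.trace = 1

/-- Steady states of the Lindblad equation: density matrices on which its generator vanishes. -/
def IsSteadyState {m : ℕ} (β ε : ℝ) (ρ : Op (m + 1)) : Prop :=
  IsDensityMatrix ρ ∧ lindbladian β ε ρ = 0

/-- The Gibbs state `e^{-βK} / Tr e^{-βK}` of the Hamiltonian `K`. -/
noncomputable def gibbsState {n : ℕ} (β : ℝ) (K : Op n) : Op n :=
  (NormedSpace.exp (-β • K)).trace⁻¹ • NormedSpace.exp (-β • K)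

end SpinChain

namespace SpinChain

open Matrix
open scoped ComplexOrder

/-! ### Tensor products with the first site -/

section Tensor

variable {m : ℕ}

/-! The product state `ρ̄` is a multiple of `e^{-βN}`. Each hopping term conserves `N`, so `ρ̄`
commutes with `H`; the reset fixes it too, so it is steady. For uniqueness, use the inner product
`⟨X, Y⟩ = Tr (X† ρ̄⁻¹ Y)`. There `⟨X, [H, X]⟩` is real (`star_trace_commutator`) and the reset is an
orthogonal projection (`trace_conjTranspose_mul_reset_sub`). Pairing the steady equation with `X`
equates a real number with an imaginary one, so `X` is fixed by the reset and commutes with `H`.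
Hence `X = ρ̄ (1 ⊗ V)` with `1 ⊗ V` commuting with `H`, and induction along the chain makes `V`
scalar (`eq_smul_one_of_commute_hamiltonian`). The steady state is thus constant in `ε`. It is no
Gibbs state of `H - μN`: its logarithm is diagonal, which rules out hopping unless `β' = 0`, and
then all weights would be equal. -/

lemma sum_config_succ {M : Type*} [AddCommMonoid M] (f : (Fin (m + 1) → Fin 2) → M) :
    ∑ s, f s = ∑ c : Fin 2, ∑ s : Fin m → Fin 2, f (Fin.cons c s) := by
  rw [← (Fin.consEquiv fun _ : Fin (m + 1) => Fin 2).sum_comp f, Fintype.sum_prod_type]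
  rfl

lemma ext_cons {X Y : Op (m + 1)}
    (h : ∀ c c' s t, X (Fin.cons c s) (Fin.cons c' t) = Y (Fin.cons c s) (Fin.cons c' t)) :
    X = Y := by
  ext s t
  simpa using h (s 0) (t 0) (Fin.tail s) (Fin.tail t)

@[simp]
lemma boundaryTensor_cons (X : SiteOp) (Y : Op m) (c c' : Fin 2) (s t : Fin m → Fin 2) :
    boundaryTensor X Y (Fin.cons c s) (Fin.cons c' t) = X c c' * Y s t := by
  simp [boundaryTensor]

lemma boundaryTensor_mul (X X' : SiteOp) (Y Y' : Op m) :
    boundaryTensor X Y * boundaryTensor X' Y' = boundaryTensor (X * X') (Y * Y') := by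
  refine ext_cons fun c c' s t => ?_
  rw [mul_apply, sum_config_succ]
  simp only [boundaryTensor_cons, mul_apply, Finset.sum_mul_sum]
  exact Finset.sum_congr rfl fun _ _ => Finset.sum_congr rfl fun _ _ => by ring

lemma boundaryTensor_conjTranspose (X : SiteOp) (Y : Op m) :
    (boundaryTensor X Y)ᴴ = boundaryTensor Xᴴ Yᴴ := by
  refine ext_cons fun c c' s t => ?_
  simp [conjTranspose_apply]

@[simp]
lemma boundaryTensor_one_one : boundaryTensor (1 : SiteOp) (1 : Op m) = 1 := by
  refine ext_cons fun c c' s t => ?_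
  simp only [boundaryTensor_cons, one_apply, Fin.cons_inj]
  split_ifs <;> simp_all

lemma boundaryTensor_add_right (X : SiteOp) (Y Y' : Op m) :
    boundaryTensor X (Y + Y') = boundaryTensor X Y + boundaryTensor X Y' := by
  refine ext_cons fun c c' s t => ?_
  simp [mul_add]

lemma boundaryTensor_sum_right {ι : Type*} (X : SiteOp) (u : Finset ι) (Y : ι → Op m) :
    boundaryTensor X (∑ i ∈ u, Y i) = ∑ i ∈ u, boundaryTensor X (Y i) := by
  refine ext_cons fun c c' s t => ?_
  simp [Matrix.sum_apply, Finset.mul_sum]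

lemma boundaryTensor_smul_right (c : ℂ) (X : SiteOp) (Y : Op m) :
    boundaryTensor X (c • Y) = c • boundaryTensor X Y := by
  refine ext_cons fun c c' s t => ?_
  simp [mul_left_comm]

lemma boundaryTensor_smul_left (c : ℂ) (X : SiteOp) (Y : Op m) :
    boundaryTensor (c • X) Y = c • boundaryTensor X Y := by
  refine ext_cons fun c c' s t => ?_
  simp [mul_assoc]

lemma siteTensor_succ (M : Fin (m + 1) → SiteOp) :
    siteTensor M = boundaryTensor (M 0) (siteTensor fun k => M k.succ) := by
  refine ext_cons fun c c' s t => ?_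
  simp [siteTensor, Fin.prod_univ_succ]

lemma siteTensor_one {n : ℕ} : siteTensor (fun _ : Fin n => (1 : SiteOp)) = 1 := by
  induction n with
  | zero => ext s t; simp [siteTensor, one_apply, Subsingleton.elim s t]
  | succ n ih => rw [siteTensor_succ, ih, boundaryTensor_one_one]

lemma trace_boundaryTensor (X : SiteOp) (Y : Op m) :
    (boundaryTensor X Y).trace = X.trace * Y.trace := by
  simp only [trace, diag_apply]
  rw [sum_config_succ]
  simp [add_mul, Finset.mul_sum, Finset.sum_add_distrib]

lemma boundaryTrace_boundaryTensor (X : SiteOp) (Y : Op m) :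
    boundaryTrace (boundaryTensor X Y) = X.trace • Y := by
  ext s t
  simp [boundaryTrace, trace, add_mul]

lemma boundaryTrace_sub (X Y : Op (m + 1)) :
    boundaryTrace (X - Y) = boundaryTrace X - boundaryTrace Y := by
  ext s t
  simp [boundaryTrace]

/-- The partial trace is adjoint to `Y ↦ 1 ⊗ Y`. -/
lemma trace_boundaryTensor_one_mul (Y : Op m) (Q : Op (m + 1)) :
    (boundaryTensor 1 Y * Q).trace = (Y * boundaryTrace Q).trace := by
  simp only [trace, diag_apply, mul_apply, boundaryTrace, of_apply]
  rw [sum_config_succ, Finset.sum_comm]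
  refine Finset.sum_congr rfl fun s _ => ?_
  simp only [sum_config_succ, boundaryTensor_cons, one_apply]
  simp [Finset.sum_add_distrib, mul_add]

end Tensor

/-! ### The fermion operators -/

section Fermions

variable {m : ℕ}

lemma parity_conjTranspose : parityᴴ = parity := by
  ext i j; fin_cases i <;> fin_cases j <;> simp [parity, conjTranspose_apply]

lemma parity_mul_parity : parity * parity = 1 := by
  ext i j; fin_cases i <;> fin_cases j <;> simp [parity, mul_apply]

lemma raising_mul_parity : loweringᴴ * parity = loweringᴴ := by
  ext i j; fin_cases i <;> fin_cases j <;> simp [parity, lowering, mul_apply]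

lemma parity_mul_lowering : parity * lowering = lowering := by
  ext i j; fin_cases i <;> fin_cases j <;> simp [parity, lowering, mul_apply]

lemma annih_zero : annih (0 : Fin (m + 1)) = boundaryTensor lowering 1 := by
  rw [annih, siteTensor_succ]
  simp [Fin.succ_ne_zero, siteTensor_one]

lemma annih_succ (j : Fin m) : annih j.succ = boundaryTensor parity (annih j) := by
  rw [annih, siteTensor_succ]
  simp [annih, Fin.succ_lt_succ_iff]

lemma annih_succ_conjTranspose_mul (i j : Fin m) :
    (annih i.succ)ᴴ * annih j.succ = boundaryTensor 1 ((annih i)ᴴ * annih j) := by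
  rw [annih_succ, annih_succ, boundaryTensor_conjTranspose, boundaryTensor_mul,
    parity_conjTranspose, parity_mul_parity]

lemma hamiltonian_zero : hamiltonian 0 = 0 := by simp [hamiltonian]

/-- The Jordan-Wigner strings disappear: they square to one on the later bonds, and on the first
bond the parity is absorbed by the raising or lowering operator. This recursion drives the
inductions on chain length. -/
lemma hamiltonian_succ (m : ℕ) :
    hamiltonian (m + 1) = boundaryTensor loweringᴴ (boundaryTensor lowering 1) +
      boundaryTensor lowering (boundaryTensor loweringᴴ 1) + boundaryTensor 1 (hamiltonian m) := by
  rw [hamiltonian, Fin.sum_univ_succ, Fin.castSucc_zero, annih_succ, annih_zero, annih_zero]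
  simp only [← Fin.succ_castSucc, annih_succ_conjTranspose_mul]
  simp only [← boundaryTensor_add_right, ← boundaryTensor_sum_right]
  rw [boundaryTensor_conjTranspose, boundaryTensor_conjTranspose, boundaryTensor_mul,
    boundaryTensor_mul, parity_conjTranspose, raising_mul_parity, parity_mul_lowering,
    boundaryTensor_conjTranspose, conjTranspose_one, one_mul, mul_one,
    conjTranspose_one]
  rfl

lemma hamiltonian_isHermitian (m : ℕ) : (hamiltonian m).IsHermitian := by
  simp only [IsHermitian, hamiltonian, conjTranspose_sum, conjTranspose_add, conjTranspose_mul,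
    conjTranspose_conjTranspose]
  exact Finset.sum_congr rfl fun _ _ => add_comm _ _

lemma number_zero : number 0 = 0 := by simp [number]

lemma number_succ (n : ℕ) :
    number (n + 1) = boundaryTensor (loweringᴴ * lowering) 1 + boundaryTensor 1 (number n) := by
  rw [number, Fin.sum_univ_succ]
  simp only [annih_succ_conjTranspose_mul, ← boundaryTensor_sum_right]
  rw [annih_zero, boundaryTensor_conjTranspose, boundaryTensor_mul, conjTranspose_one, one_mul]
  rfl

lemma number_eq_diagonal (n : ℕ) :
    number n = diagonal fun s => ((∑ k, (s k : ℕ) : ℕ) : ℂ) := by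
  induction n with
  | zero => rw [number_zero]; ext s t; simp [diagonal_apply]
  | succ n ih =>
    rw [number_succ, ih]
    refine ext_cons fun c c' s t => ?_
    simp only [Matrix.add_apply, boundaryTensor_cons, diagonal_apply, one_apply, Fin.cons_inj,
      Fin.sum_univ_succ, Fin.cons_zero, Fin.cons_succ]
    by_cases hst : s = t <;> fin_cases c <;> fin_cases c' <;>
      simp [hst, lowering, mul_apply, conjTranspose_apply]

end Fermions

/-! ### Operators commuting with the Hamiltonian -/

section Commutant

variable {m : ℕ}

/-- `|0⟩⟨1|` and its adjoint generate all one-site operators, and the commutant of `M₂ ⊗ 1` is `1 ⊗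
B`. -/
lemma eq_boundaryTensor_one_of_commute {W : Op (m + 1)}
    (h : Commute (boundaryTensor lowering 1) W) (h' : Commute (boundaryTensor loweringᴴ 1) W) :
    ∃ V : Op m, W = boundaryTensor 1 V := by
  have key : ∀ X : SiteOp, Commute (boundaryTensor X 1) W → ∀ c c' s t,
      ∑ b, X c b * W (Fin.cons b s) (Fin.cons c' t) =
        ∑ b, W (Fin.cons c s) (Fin.cons b t) * X b c' := by
    intro X hX c c' s t
    have := congrFun (congrFun hX.eq (Fin.cons c s)) (Fin.cons c' t)
    simp only [mul_apply, sum_config_succ, boundaryTensor_cons, one_apply] at this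
    simpa using this
  refine ⟨of fun s t => W (Fin.cons 0 s) (Fin.cons 0 t), ext_cons fun c c' s t => ?_⟩
  -- As a block matrix over the first site, `W` has equal diagonal blocks by `h₁` and zero
  -- off-diagonal blocks by `h₂` and `h₃`.
  have h₁ := key _ h 0 1 s t
  have h₂ := key _ h 0 0 s t
  have h₃ := key _ h' 0 0 s t
  clear key
  simp [lowering, conjTranspose_apply] at h₁ h₂ h₃
  fin_cases c <;> fin_cases c' <;> simp [h₁, h₂, ← h₃]

/-- Operators on all sites but the first that commute with the Hamiltonian are scalar. -/
lemma eq_smul_one_of_commute_hamiltonian (m : ℕ) (V : Op m)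
    (h : Commute (hamiltonian m) (boundaryTensor 1 V)) : ∃ c : ℂ, V = c • 1 := by
  induction m with
  | zero =>
    refine ⟨V 0 0, ?_⟩
    ext s t
    simp [Subsingleton.elim s 0, Subsingleton.elim t 0]
  | succ m ih =>
    have key := h.eq
    rw [hamiltonian_succ] at key
    simp only [add_mul, mul_add, boundaryTensor_mul, one_mul, mul_one] at key
    have entry : ∀ c c' s t, _ := fun c c' s t =>
      congrFun (congrFun key (Fin.cons c s)) (Fin.cons c' t)
    simp only [Matrix.add_apply, boundaryTensor_cons] at entry
    -- The first-site blocks separate the three terms of `H`: the off-diagonal ones isolate the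
    -- hopping across the first bond, the diagonal one the rest of the chain.
    have h₁ : Commute (boundaryTensor lowering 1) V := by
      ext s t; simpa [lowering, conjTranspose_apply] using entry 1 0 s t
    have h₂ : Commute (boundaryTensor loweringᴴ 1) V := by
      ext s t; simpa [lowering, conjTranspose_apply] using entry 0 1 s t
    have h₃ : Commute (hamiltonian m) V := by
      ext s t; simpa [lowering, conjTranspose_apply] using entry 0 0 s t
    obtain ⟨U, rfl⟩ := eq_boundaryTensor_one_of_commute h₁ h₂
    obtain ⟨c, rfl⟩ := ih U h₃
    exact ⟨c, by rw [boundaryTensor_smul_right, boundaryTensor_one_one]⟩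

end Commutant

/-! ### The product state -/

section ProductState

/-- The probability of the occupation number `c` in the one-site state. -/
noncomputable def siteWeight (β : ℝ) (c : Fin 2) : ℝ :=
  (1 + Real.exp (-β))⁻¹ * Real.exp (-β * (c : ℕ))

/-- The probability of the configuration `s` in the product state. -/
noncomputable def weight (β : ℝ) {n : ℕ} (s : Fin n → Fin 2) : ℝ := ∏ k, siteWeight β (s k)

lemma siteWeight_pos (β : ℝ) (c : Fin 2) : 0 < siteWeight β c := by
  unfold siteWeight; positivity

lemma weight_pos (β : ℝ) {n : ℕ} (s : Fin n → Fin 2) : 0 < weight β s :=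
  Finset.prod_pos fun _ _ => siteWeight_pos β _

lemma siteState_eq_diagonal (β : ℝ) :
    siteState β = diagonal fun c => (siteWeight β c : ℂ) := by
  ext i j
  fin_cases i <;> fin_cases j <;> simp [siteState, siteWeight]

lemma productState_succ (β : ℝ) (n : ℕ) :
    productState β (n + 1) = boundaryTensor (siteState β) (productState β n) :=
  siteTensor_succ _

lemma productState_eq_diagonal (β : ℝ) (n : ℕ) :
    productState β n = diagonal fun s => (weight β s : ℂ) := by
  induction n with
  | zero =>
    ext s t
    simp [productState, siteTensor, weight, Subsingleton.elim s t]
  | succ n ih =>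
    rw [productState_succ, ih, siteState_eq_diagonal]
    refine ext_cons fun c c' s t => ?_
    simp only [boundaryTensor_cons, diagonal_apply, Fin.cons_inj, weight, Fin.prod_univ_succ,
      Fin.cons_zero, Fin.cons_succ]
    split_ifs <;> simp_all

lemma siteState_trace (β : ℝ) : (siteState β).trace = 1 := by
  have h : (1 + Real.exp (-β) : ℝ) ≠ 0 := by positivity
  rw [siteState_eq_diagonal, trace_diagonal, Fin.sum_univ_two]
  norm_cast
  simp only [siteWeight]
  field_simp
  simp

lemma productState_trace (β : ℝ) (n : ℕ) : (productState β n).trace = 1 := by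
  induction n with
  | zero => simp [trace, productState, siteTensor]
  | succ n ih => rw [productState_succ, trace_boundaryTensor, siteState_trace, ih, mul_one]

lemma boundaryTrace_productState (β : ℝ) (m : ℕ) :
    boundaryTrace (productState β (m + 1)) = productState β m := by
  rw [productState_succ, boundaryTrace_boundaryTensor, siteState_trace, one_smul]

lemma productState_isDensityMatrix (β : ℝ) (n : ℕ) : IsDensityMatrix (productState β n) := by
  refine ⟨?_, productState_trace β n⟩
  rw [productState_eq_diagonal, posSemidef_diagonal_iff]
  exact fun s => by exact_mod_cast (weight_pos β s).le

/-- The inverse of the product state. -/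
noncomputable def productStateInv (β : ℝ) (n : ℕ) : Op n :=
  diagonal fun s => ((weight β s)⁻¹ : ℂ)

lemma productStateInv_isHermitian (β : ℝ) (n : ℕ) : (productStateInv β n).IsHermitian := by
  rw [productStateInv, IsHermitian, diagonal_conjTranspose]
  congr 1
  ext s
  simp

lemma productState_mul_productStateInv (β : ℝ) (n : ℕ) :
    productState β n * productStateInv β n = 1 := by
  rw [productState_eq_diagonal, productStateInv, diagonal_mul_diagonal, ← diagonal_one]
  congr 1
  ext s
  exact mul_inv_cancel₀ (by exact_mod_cast (weight_pos β s).ne')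

lemma productStateInv_mul_productState (β : ℝ) (n : ℕ) :
    productStateInv β n * productState β n = 1 :=
  mul_eq_one_comm.mp (productState_mul_productStateInv β n)

/-- Puts the range of the reset in the form `ρ̄ (1 ⊗ V)`, used both for orthogonality and for
uniqueness. -/
lemma productStateInv_mul_boundaryTensor_siteState (β : ℝ) {m : ℕ} (Y : Op m) :
    productStateInv β (m + 1) * boundaryTensor (siteState β) Y =
      boundaryTensor 1 (productStateInv β m * Y) := by
  have h : boundaryTensor (siteState β) Y =
      productState β (m + 1) * boundaryTensor 1 (productStateInv β m * Y) := by
    rw [productState_succ, boundaryTensor_mul, mul_one, ← mul_assoc,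
      productState_mul_productStateInv, one_mul]
  rw [h, ← mul_assoc, productStateInv_mul_productState, one_mul]

lemma trace_conjTranspose_mul_productStateInv_mul (β : ℝ) {n : ℕ} (Q : Op n) :
    (Qᴴ * (productStateInv β n * Q)).trace =
      ((∑ t, ∑ s, (weight β s)⁻¹ * ‖Q s t‖ ^ 2 : ℝ) : ℂ) := by
  simp only [trace, diag_apply, mul_apply (M := Qᴴ), productStateInv, diagonal_mul,
    conjTranspose_apply]
  push_cast
  refine Finset.sum_congr rfl fun t _ => Finset.sum_congr rfl fun s _ => ?_
  rw [← Complex.conj_mul']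
  simp only [RCLike.star_def]
  ring

lemma siteState_mul_lowering (β : ℝ) :
    siteState β * lowering = (Real.exp β : ℂ) • (lowering * siteState β) := by
  have h := Complex.exp_ne_zero β
  rw [siteState_eq_diagonal]
  ext i j
  simp only [Matrix.smul_apply, mul_diagonal, diagonal_mul]
  fin_cases i <;> fin_cases j <;> simp [lowering, siteWeight, Complex.exp_neg] <;> field_simp

lemma raising_mul_siteState (β : ℝ) :
    loweringᴴ * siteState β = (Real.exp β : ℂ) • (siteState β * loweringᴴ) := by
  have h := Complex.exp_ne_zero β
  rw [siteState_eq_diagonal]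
  ext i j
  simp only [Matrix.smul_apply, mul_diagonal, diagonal_mul]
  fin_cases i <;> fin_cases j <;> simp [lowering, siteWeight, Complex.exp_neg] <;> field_simp

lemma commute_hamiltonian_productState (β : ℝ) (m : ℕ) :
    Commute (hamiltonian m) (productState β (m + 1)) := by
  induction m with
  | zero => rw [hamiltonian_zero]; exact Commute.zero_left _
  | succ m ih =>
    rw [hamiltonian_succ]
    refine ((?_ : Commute _ _).add_left ?_).add_left ?_
    -- Both products reduce to the same `e^β` multiple: one picks up the factor from the raising
    -- operator, the other from the lowering one.
    · rw [Commute, SemiconjBy, productState_succ, productState_succ]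
      simp only [boundaryTensor_mul, one_mul, mul_one, siteState_mul_lowering,
        raising_mul_siteState, boundaryTensor_smul_left, boundaryTensor_smul_right]
    · rw [Commute, SemiconjBy, productState_succ, productState_succ]
      simp only [boundaryTensor_mul, one_mul, mul_one, siteState_mul_lowering,
        raising_mul_siteState, boundaryTensor_smul_left, boundaryTensor_smul_right]
    · rw [Commute, SemiconjBy, productState_succ, boundaryTensor_mul, boundaryTensor_mul, ih.eq,
        one_mul, mul_one]

lemma productState_isSteadyState (β ε : ℝ) (m : ℕ) :
    IsSteadyState β ε (productState β (m + 1)) := by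
  refine ⟨productState_isDensityMatrix β _, ?_⟩
  rw [lindbladian, dissipator, boundaryTrace_productState, ← productState_succ,
    (commute_hamiltonian_productState β m).eq]
  simp

lemma productState_eq_exp_number (β : ℝ) (n : ℕ) :
    productState β n =
      (1 / (1 + Real.exp (-β))) ^ n • NormedSpace.exp (-β • number n) := by
  rw [number_eq_diagonal, ← diagonal_smul, exp_diagonal, ← diagonal_smul, productState_eq_diagonal]
  congr 1
  ext s
  rw [Pi.smul_apply, Pi.coe_exp, ← Complex.exp_eq_exp_ℂ]
  simp only [weight, siteWeight, Finset.prod_mul_distrib, Finset.prod_const, Finset.card_univ,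
    Fintype.card_fin, ← Real.exp_sum, ← Finset.mul_sum]
  simp [Complex.real_smul]

end ProductState

/-! ### Uniqueness of the steady state -/

section Uniqueness

variable {m : ℕ}

/-- The commutator with the Hamiltonian is skew-adjoint for the inner product
`⟨X, Y⟩ = Tr (X† ρ̄⁻¹ Y)`. -/
lemma star_trace_commutator (β : ℝ) (X : Op (m + 1)) :
    star (Xᴴ * (productStateInv β (m + 1) *
      (hamiltonian m * X - X * hamiltonian m))).trace =
    (Xᴴ * (productStateInv β (m + 1) * (hamiltonian m * X - X * hamiltonian m))).trace := by
  have hH := hamiltonian_isHermitian m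
  have hD := productStateInv_isHermitian β (m + 1)
  have hc : productStateInv β (m + 1) * hamiltonian m =
      hamiltonian m * productStateInv β (m + 1) := by
    have h := (commute_hamiltonian_productState β m).eq
    calc _ = productStateInv β (m + 1) * (hamiltonian m *
          (productState β (m + 1) * productStateInv β (m + 1))) := by
          rw [productState_mul_productStateInv, mul_one]
      _ = productStateInv β (m + 1) * (hamiltonian m *
          productState β (m + 1)) * productStateInv β (m + 1) := by simp only [mul_assoc]
      _ = _ := by
          rw [h, ← mul_assoc, productStateInv_mul_productState, one_mul]
  generalize productStateInv β (m + 1) = D at *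
  generalize hamiltonian m = H at *
  simp only [mul_sub, trace_sub, star_sub]
  -- The two traces are separately real: the first because `D * H` is Hermitian, the second by
  -- cyclicity.
  congr 1
  · rw [← trace_conjTranspose]
    simp only [conjTranspose_mul, conjTranspose_conjTranspose, hH.eq, hD.eq]
    rw [mul_assoc, mul_assoc, ← mul_assoc H D, ← hc, mul_assoc]
  · rw [← trace_conjTranspose]
    simp only [conjTranspose_mul, conjTranspose_conjTranspose, hH.eq, hD.eq]
    rw [mul_assoc, mul_assoc, trace_mul_comm H]
    simp only [mul_assoc]

/-- The projection `X ↦ ρ̂_A ⊗ Tr_A X` is orthogonal for the inner product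
`⟨X, Y⟩ = Tr (X† ρ̄⁻¹ Y)`. -/
lemma trace_conjTranspose_mul_reset_sub (β : ℝ) (X : Op (m + 1)) :
    (Xᴴ * (productStateInv β (m + 1) *
      (boundaryTensor (siteState β) (boundaryTrace X) - X))).trace =
    -((boundaryTensor (siteState β) (boundaryTrace X) - X)ᴴ * (productStateInv β (m + 1) *
      (boundaryTensor (siteState β) (boundaryTrace X) - X))).trace := by
  set E := boundaryTensor (siteState β) (boundaryTrace X) with hE
  -- `E† ρ̄⁻¹` has the form `1 ⊗ Y`, so only the partial trace of `E - X` matters, and it vanishes.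
  have h : (Eᴴ * (productStateInv β (m + 1) * (E - X))).trace = 0 := by
    have h₁ : Eᴴ * productStateInv β (m + 1) =
        boundaryTensor 1 (productStateInv β m * boundaryTrace X)ᴴ := by
      rw [← (productStateInv_isHermitian β (m + 1)).eq, ← conjTranspose_mul, hE,
        productStateInv_mul_boundaryTensor_siteState, boundaryTensor_conjTranspose,
        conjTranspose_one]
    rw [← mul_assoc, h₁, trace_boundaryTensor_one_mul, boundaryTrace_sub, hE,
      boundaryTrace_boundaryTensor, siteState_trace, one_smul, sub_self, mul_zero, trace_zero]
  rw [conjTranspose_sub, sub_mul, trace_sub, h]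
  ring

/-- An operator annihilated by the generator is invariant under the reset and commutes with the
Hamiltonian. -/
lemma reset_eq_of_lindbladian_eq_zero {β ε : ℝ} (hε : 0 < ε) {X : Op (m + 1)}
    (h : lindbladian β ε X = 0) :
    boundaryTensor (siteState β) (boundaryTrace X) = X ∧ Commute (hamiltonian m) X := by
  set Q := boundaryTensor (siteState β) (boundaryTrace X) - X with hQ
  set C := hamiltonian m * X - X * hamiltonian m with hC
  have hL : (ε : ℂ) • Q = Complex.I • C := by
    have : -Complex.I • C + ε • Q = 0 := h
    rw [neg_smul, neg_add_eq_zero] at this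
    rw [this]
    ext s t
    simp
  have hQ0 : Q = 0 := by
    have h₁ : (Xᴴ * (productStateInv β (m + 1) * ((ε : ℂ) • Q))).trace =
        (Xᴴ * (productStateInv β (m + 1) * (Complex.I • C))).trace := by rw [hL]
    rw [mul_smul_comm, mul_smul_comm, mul_smul_comm, mul_smul_comm, trace_smul, trace_smul,
      smul_eq_mul, smul_eq_mul, hQ, trace_conjTranspose_mul_reset_sub, ← hQ,
      trace_conjTranspose_mul_productStateInv_mul] at h₁
    have h₂ := star_trace_commutator β X
    rw [← hC] at h₂
    obtain ⟨r, hr⟩ := Complex.conj_eq_iff_real.mp h₂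
    rw [hr] at h₁
    -- The left side is `-ε` times the squared weighted norm of `Q`, the right side is `i r` with
    -- `r` real.
    have h₃ := congrArg Complex.re h₁
    simp only [Complex.mul_re, Complex.neg_re, Complex.neg_im, Complex.ofReal_re,
      Complex.ofReal_im, Complex.I_re, Complex.I_im] at h₃
    have h₄ : ∑ t, ∑ s, (weight β s)⁻¹ * ‖Q s t‖ ^ 2 = 0 := by
      simpa [hε.ne'] using h₃
    have hnn : ∀ s t, 0 ≤ (weight β s)⁻¹ * ‖Q s t‖ ^ 2 := fun s t =>
      mul_nonneg (inv_nonneg.mpr (weight_pos β s).le) (sq_nonneg _)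
    rw [Finset.sum_eq_zero_iff_of_nonneg fun t _ => Finset.sum_nonneg fun s _ => hnn s t] at h₄
    ext s t
    have h₅ := (Finset.sum_eq_zero_iff_of_nonneg fun s _ => hnn s t).mp
      (h₄ t (Finset.mem_univ t)) s (Finset.mem_univ s)
    simpa [(weight_pos β s).ne'] using h₅
  refine ⟨sub_eq_zero.mp hQ0, ?_⟩
  rw [hQ0, smul_zero, eq_comm, smul_eq_zero] at hL
  exact sub_eq_zero.mp (hL.resolve_left Complex.I_ne_zero)

lemma eq_productState_of_isSteadyState {β ε : ℝ} (hε : 0 < ε) {ρ : Op (m + 1)}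
    (h : IsSteadyState β ε ρ) : ρ = productState β (m + 1) := by
  obtain ⟨hE, hH⟩ := reset_eq_of_lindbladian_eq_zero hε h.2
  set V := productStateInv β m * boundaryTrace ρ
  have hV : ρ = productState β (m + 1) * boundaryTensor 1 V := by
    rw [← productStateInv_mul_boundaryTensor_siteState, hE, ← mul_assoc,
      productState_mul_productStateInv, one_mul]
  -- `ρ̄` is invertible and commutes with `H`, so it cancels.
  have hc : Commute (hamiltonian m) (boundaryTensor 1 V) := by
    have h₁ := hH.eq
    rw [hV, ← mul_assoc, (commute_hamiltonian_productState β m).eq, mul_assoc, mul_assoc] at h₁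
    simpa [Commute, SemiconjBy, ← mul_assoc, productStateInv_mul_productState] using
      congrArg (productStateInv β (m + 1) * ·) h₁
  obtain ⟨c, hc⟩ := eq_smul_one_of_commute_hamiltonian m V hc
  rw [hc, boundaryTensor_smul_right, boundaryTensor_one_one, mul_smul_comm, mul_one] at hV
  have ht := h.1.2
  rw [hV, trace_smul, productState_trace, smul_eq_mul, mul_one] at ht
  rw [hV, ht, one_smul]

end Uniqueness

/-! ### Gibbs states -/

section Gibbs

-- The logarithm of the continuous functional calculus inverts the exponential on Hermitian
-- matrices; the operator norm supplies the C⋆-structure.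
open scoped Matrix.Norms.L2Operator in
lemma exp_injective_of_isHermitian {n : ℕ} {K L : Op n} (hK : K.IsHermitian) (hL : L.IsHermitian)
    (h : NormedSpace.exp K = NormedSpace.exp L) : K = L := by
  rw [← CFC.log_exp K hK, h, CFC.log_exp L hL]

lemma posSemidef_exp {n : ℕ} {K : Op n} (hK : K.IsHermitian) :
    (NormedSpace.exp K).PosSemidef := by
  have h : NormedSpace.exp K =
      (NormedSpace.exp ((1 / 2 : ℝ) • K))ᴴ * NormedSpace.exp ((1 / 2 : ℝ) • K) := by
    have h₁ : ((1 / 2 : ℝ) • K)ᴴ = (1 / 2 : ℝ) • K := by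
      rw [conjTranspose_smul, hK.eq, star_trivial]
    rw [← exp_conjTranspose, h₁, ← Matrix.exp_add_of_commute _ _ (Commute.refl _), ← add_smul]
    norm_num
  rw [h]
  exact posSemidef_conjTranspose_mul_self _

/-- A Hermitian operator whose Gibbs weight is a multiple of the product state is diagonal. -/
lemma eq_diagonal_of_exp {n : ℕ} {β : ℝ} {K : Op n} (hK : K.IsHermitian)
    (h : productState β n = (NormedSpace.exp K).trace⁻¹ • NormedSpace.exp K) :
    ∃ z : ℝ, 0 < z ∧ K = diagonal fun s => (Real.log (z * weight β s) : ℂ) := by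
  have h0 : (NormedSpace.exp K).trace ≠ 0 := by
    intro h0
    have := productState_trace β n
    rw [h, h0, _root_.inv_zero, zero_smul, trace_zero] at this
    exact zero_ne_one this
  have hpos : 0 < (NormedSpace.exp K).trace := (posSemidef_exp hK).trace_nonneg.lt_of_ne' h0
  obtain ⟨hre, him⟩ := Complex.pos_iff.mp hpos
  -- `z` is the partition function `Tr e^K`, so that `e^K = z ρ̄`.
  refine ⟨_, hre, exp_injective_of_isHermitian hK ?_ ?_⟩
  · rw [IsHermitian, diagonal_conjTranspose]
    congr 1
    ext s
    exact Complex.conj_ofReal _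
  · have hz : (NormedSpace.exp K).trace = ((NormedSpace.exp K).trace.re : ℂ) :=
      Complex.ext rfl (by simp [← him])
    have h₁ : NormedSpace.exp K = (NormedSpace.exp K).trace • productState β n := by
      rw [h, smul_smul, mul_inv_cancel₀ h0, one_smul]
    rw [exp_diagonal]
    refine h₁.trans ?_
    rw [productState_eq_diagonal, ← diagonal_smul]
    congr 1
    ext s
    rw [Pi.coe_exp, ← Complex.exp_eq_exp_ℂ, ← Complex.ofReal_exp,
      Real.exp_log (mul_pos hre (weight_pos β s)), Pi.smul_apply, smul_eq_mul,
      Complex.ofReal_mul, ← hz]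

lemma number_isHermitian (n : ℕ) : (number n).IsHermitian := by
  simp only [IsHermitian, number, conjTranspose_sum, conjTranspose_mul, conjTranspose_conjTranspose]

lemma hamiltonian_succ_apply (m : ℕ) :
    hamiltonian (m + 1) (Fin.cons 1 (Fin.cons 0 0)) (Fin.cons 0 (Fin.cons 1 0)) = 1 := by
  rw [hamiltonian_succ]
  simp [lowering, conjTranspose_apply]

lemma productState_ne_gibbsState (m : ℕ) {β : ℝ} (hβ : 0 < β) (β' μ : ℝ) :
    productState β (m + 2) ≠ gibbsState β' (hamiltonian (m + 1) - μ • number (m + 2)) := by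
  intro h
  have hK : (-β' • (hamiltonian (m + 1) - μ • number (m + 2))).IsHermitian := by
    rw [IsHermitian, conjTranspose_smul, conjTranspose_sub, conjTranspose_smul,
      (hamiltonian_isHermitian _).eq, (number_isHermitian _).eq, star_trivial, star_trivial]
  obtain ⟨z, hz, hd⟩ := eq_diagonal_of_exp hK h
  have hne : (Fin.cons 1 (Fin.cons 0 0) : Fin (m + 2) → Fin 2) ≠ Fin.cons 0 (Fin.cons 1 0) := by
    simp [Fin.cons_inj]
  -- At this off-diagonal entry `N` vanishes and `H` equals 1, leaving `-β' = 0`.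
  have hβ' : β' = 0 := by
    have := congrFun (congrFun hd (Fin.cons 1 (Fin.cons 0 0))) (Fin.cons 0 (Fin.cons 1 0))
    rw [diagonal_apply_ne _ hne, number_eq_diagonal] at this
    simpa [diagonal_apply_ne _ hne, hamiltonian_succ_apply] using this
  rw [hβ', neg_zero, zero_smul] at hd
  have hlog : ∀ s : Fin (m + 2) → Fin 2, z * weight β s = 1 := by
    intro s
    have := congrFun (congrFun hd s) s
    rw [diagonal_apply_eq, Matrix.zero_apply, eq_comm, Complex.ofReal_eq_zero] at this
    exact Real.eq_one_of_pos_of_log_eq_zero (mul_pos hz (weight_pos β s)) this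
  -- The empty chain and a single particle on the first site have weights in ratio `1 : e^{-β}`.
  have h₁ : weight β (Fin.cons 0 0 : Fin (m + 2) → Fin 2) =
      weight β (Fin.cons 1 0 : Fin (m + 2) → Fin 2) :=
    mul_left_cancel₀ hz.ne' ((hlog _).trans (hlog _).symm)
  have hw : (0 : ℝ) < weight β (0 : Fin (m + 1) → Fin 2) := weight_pos β _
  have hβ1 : Real.exp (-β) < 1 := Real.exp_lt_one_iff.mpr (neg_neg_of_pos hβ)
  simp only [weight, Fin.prod_univ_succ (n := m + 1), Fin.cons_zero, Fin.cons_succ] at h₁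
  have h₂ := mul_right_cancel₀ hw.ne' h₁
  have h₃ : (1 + Real.exp (-β))⁻¹ ≠ 0 := by positivity
  have h₄ : Real.exp (-β) = 1 := by
    simpa [siteWeight, eq_comm] using mul_left_cancel₀ h₃ h₂
  exact hβ1.ne h₄

end Gibbs

end SpinChain

theorem mainTheorem5 (m : ℕ) (hm : 1 ≤ m) (β : ℝ) (hβ : 0 < β) :
    (∀ ε : ℝ, 0 < ε → ∀ ρ : SpinChain.Op (m + 1),
      SpinChain.IsSteadyState β ε ρ ↔ ρ = SpinChain.productState β (m + 1)) ∧
    SpinChain.productState β (m + 1) =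
      (1 / (1 + Real.exp (-β))) ^ (m + 1) • NormedSpace.exp (-β • SpinChain.number (m + 1)) ∧
    SpinChain.productState β (m + 1) =
      SpinChain.boundaryTensor (SpinChain.siteState β) (SpinChain.productState β m) ∧
    (∀ ρ : ℝ → SpinChain.Op (m + 1), (∀ ε : ℝ, 0 < ε → SpinChain.IsSteadyState β ε (ρ ε)) →
      ∀ β' μ : ℝ, ¬ Filter.Tendsto ρ (nhdsWithin 0 (Set.Ioi 0))
        (nhds (SpinChain.gibbsState β'
          (SpinChain.hamiltonian m - μ • SpinChain.number (m + 1))))) := by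
  refine ⟨fun ε hε ρ => ⟨SpinChain.eq_productState_of_isSteadyState hε, ?_⟩,
    SpinChain.productState_eq_exp_number β _, SpinChain.productState_succ β m,
    fun ρ hρ β' μ hlim => ?_⟩
  · rintro rfl
    exact SpinChain.productState_isSteadyState β ε m
  -- At least two sites are needed for a hopping term to exist.
  · obtain ⟨m, rfl⟩ := Nat.exists_eq_add_of_le' hm
    refine SpinChain.productState_ne_gibbsState m hβ β' μ (tendsto_nhds_unique ?_ hlim)
    refine tendsto_const_nhds.congr' ?_
    filter_upwards [self_mem_nhdsWithin] with ε hε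
    exact (SpinChain.eq_productState_of_isSteadyState hε (hρ ε hε)).symm
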